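/- Let $s,n\in\mathbb N$, $W\in\mathbb R^{s\times n}$, $q\in\mathbb R^n$, and let $$\varphi(t)=\min\{q^\top y \mid Wy=t,\ y\ge 0\},\qquad t\in\mathbb R^s.$$ Let $\mu$ be a Borel probability measure on $\mathbb R^s$, and for $x\in\mathbb R^s$, $\eta\in\mathbb R$ let $$Q_{EE}(x,\eta)=\int_{\mathbb R^s}\max\{0,\varphi(z-x)-\eta\}\,\mu(\mathrm dz).$$ Let $\|\cdot\|$ be the Euclidean norm and $B_\rho(0)$ the ball of radius $\rho$ about $0$. Let $\{d_i\mid i\in I\}$ be the set of extreme points of the polyhedron $\{v\in\mathbb R^s\mid W^\top v\le q\}$, let $K_i=\{z\mid (d_i-d_j)^\top z\ge 0 \text{ for all } j\in I\}$ and $K_i^+=K_i\cap\{z\mid d_i^\top z\ge 0\}$, and let $I^+=\{i\in I\mid \operatorname{int}K_i^+\ne\emptyset,\ d_i\ne 0\}$. Assume the following. * (A1) For every $t\in\mathbb R^s$ there is $y\ge 0$ with $Wy=t$. * (A2) There is $v\in\mathbb R^s$ with $W^\top v<q$ componentwise. * (A3) $\int\|z\|\,\mu(\mathrm dz)<\infty$.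 * (A4) $\mu$ has a density $\theta$ with respect to Lebesgue measure, $V\subset\mathbb R^s$ is a convex open set, and $r,\rho>0$ are constants such that $\theta\ge r$ almost everywhere on $V+B_\rho(0)$. * (A5) $\eta_0>0$, and for every $i\in I^+$ a point $\hat y^i(\eta_0)$ of minimum norm among the points where the hyperplane $\{z\mid d_i^\top z=\eta_0\}$ meets an extreme ray of $K_i$ satisfies $\|\hat y^i(\eta_0)\|<\rho$. * (A6) $q>0$ componentwise. Then the integrand $z\mapsto\max\{0,\varphi(z-x)-\eta\}$ is $\mu$-integrable for all $x\in\mathbb R^s$ and $\eta\in\mathbb R$, and $Q_{EE}$ is partially strongly convex with respect to $x$ on $V\times(-\infty,\eta_0]$: there is $\kappa>0$ such that $$Q_{EE}\big(\lambda x_1+(1-\lambda)x_2,\ \lambda\eta_1+(1-\lambda)\eta_2\big)\le \lambda Q_{EE}(x_1,\eta_1)+(1-\lambda)Q_{EE}(x_2,\eta_2)-\frac{\kappa}{2}\lambda(1-\lambda)\|x_1-x_2\|^2$$ for all $x_1,x_2\in V$, all $\eta_1,\eta_2\in(-\infty,\eta_0]$ and all $\lambda\in(0,1)$. -/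

import Mathlib

open MeasureTheory
open scoped Matrix Pointwise ENNReal

noncomputable section

namespace TwoStage

/-- The Euclidean space `ℝ^s`. -/
abbrev Vec (s : ℕ) : Type := EuclideanSpace ℝ (Fin s)

variable {s n : ℕ}

/-- The value function `φ(t) = min { qᵀ y | W y = t, y ≥ 0 }` of the second-stage linear program.
(Under complete recourse and sufficiently expensive recourse the infimum is over a nonempty set
that is bounded below.) -/
def valueFun (W : Matrix (Fin s) (Fin n) ℝ) (q : Fin n → ℝ) (t : Vec s) : ℝ :=
  sInf {c : ℝ | ∃ y : Fin n → ℝ, 0 ≤ y ∧ W *ᵥ y = t.ofLp ∧ c = q ⬝ᵥ y}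

/-- The integrand `max {0, φ(z - x) - η}` of the expected excess. -/
def excess (W : Matrix (Fin s) (Fin n) ℝ) (q : Fin n → ℝ) (x : Vec s) (η : ℝ) (z : Vec s) : ℝ :=
  max 0 (valueFun W q (z - x) - η)

/-- The expected excess `Q_EE(x, η) = 𝔼_μ[max {0, φ(z - x) - η}]`. -/
def expectedExcess (W : Matrix (Fin s) (Fin n) ℝ) (q : Fin n → ℝ) (μ : Measure (Vec s))
    (x : Vec s) (η : ℝ) : ℝ :=
  ∫ z, excess W q x η z ∂μ

/-- Complete recourse. -/
def CompleteRecourse (W : Matrix (Fin s) (Fin n) ℝ) : Prop :=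
  ∀ t : Vec s, ∃ y : Fin n → ℝ, 0 ≤ y ∧ W *ᵥ y = t.ofLp

/-- Strengthened sufficiently expensive recourse: some `v` has `Wᵀ v < q` componentwise. -/
def StrictlyExpensiveRecourse (W : Matrix (Fin s) (Fin n) ℝ) (q : Fin n → ℝ) : Prop :=
  ∃ v : Vec s, ∀ j, (Wᵀ *ᵥ v.ofLp) j < q j

/-- `μ` has a Lebesgue density that is a.e. at least `r` on `V + B_ρ(0)`. -/
def HasDensityAtLeast (μ : Measure (Vec s)) (V : Set (Vec s)) (r ρ : ℝ) : Prop :=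
  ∃ θ : Vec s → ℝ≥0∞, Measurable θ ∧ μ = volume.withDensity θ ∧
    ∀ᵐ z ∂(volume : Measure (Vec s)), z ∈ V + Metric.ball (0 : Vec s) ρ → ENNReal.ofReal r ≤ θ z

/-- The dual feasible polyhedron `{v | Wᵀ v ≤ q}`. -/
def dualPolyhedron (W : Matrix (Fin s) (Fin n) ℝ) (q : Fin n → ℝ) : Set (Vec s) :=
  {v | ∀ j, (Wᵀ *ᵥ v.ofLp) j ≤ q j}

/-- The vertices `d_i` of the dual polyhedron; a vertex serves as its own index. -/
def dualVertices (W : Matrix (Fin s) (Fin n) ℝ) (q : Fin n → ℝ) : Set (Vec s) :=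
  (dualPolyhedron W q).extremePoints ℝ

/-- The cone `K_d = {z | (d - d')ᵀ z ≥ 0 for all vertices d'}` belonging to the vertex `d`. -/
def vertexCone (W : Matrix (Fin s) (Fin n) ℝ) (q : Fin n → ℝ) (d : Vec s) : Set (Vec s) :=
  {z | ∀ d' ∈ dualVertices W q, 0 ≤ inner ℝ (d - d') z}

/-- The set `I⁺` of nonzero vertices `d` for which `K_d⁺ = K_d ∩ {z | dᵀ z ≥ 0}` has nonempty
interior. -/
def positiveVertices (W : Matrix (Fin s) (Fin n) ℝ) (q : Fin n → ℝ) : Set (Vec s) :=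
  {d | d ∈ dualVertices W q ∧ d ≠ 0 ∧
    (interior (vertexCone W q d ∩ {z | 0 ≤ inner ℝ d z})).Nonempty}

/-- The ray `{c t | c ≥ 0}`. -/
def ray (t : Vec s) : Set (Vec s) :=
  {y | ∃ c : ℝ, 0 ≤ c ∧ y = c • t}

/-- The points where the hyperplane `{z | dᵀ z = η}` meets the extreme rays of `K_d`. -/
def rayPoints (W : Matrix (Fin s) (Fin n) ℝ) (q : Fin n → ℝ) (d : Vec s) (η : ℝ) :
    Set (Vec s) :=
  {y | inner ℝ d y = η ∧
    ∃ t : Vec s, t ≠ 0 ∧ IsExtreme ℝ (vertexCone W q d) (ray t) ∧ y ∈ ray t}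

/-- The threshold condition: `η₀ > 0`, and for every `d ∈ I⁺` a point of `rayPoints W q d η₀`
of minimum norm has norm less than `ρ`; that is, some point of this set has norm less than `ρ`. -/
def AdmissibleThreshold (W : Matrix (Fin s) (Fin n) ℝ) (q : Fin n → ℝ) (ρ η₀ : ℝ) : Prop :=
  0 < η₀ ∧ ∀ d ∈ positiveVertices W q, ∃ y ∈ rayPoints W q d η₀, ‖y‖ < ρ

/-- Partial `κ`-strong convexity of `f` on `V × Y` with respect to the first argument. -/
def PartiallyStronglyConvexOn {E F : Type*} [NormedAddCommGroup E] [NormedSpace ℝ E]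
    [NormedAddCommGroup F] [NormedSpace ℝ F] (κ : ℝ) (V : Set E) (Y : Set F)
    (f : E → F → ℝ) : Prop :=
  ∀ x₁ ∈ V, ∀ x₂ ∈ V, ∀ y₁ ∈ Y, ∀ y₂ ∈ Y, ∀ l : ℝ, 0 < l → l < 1 →
    f (l • x₁ + (1 - l) • x₂) (l • y₁ + (1 - l) • y₂) ≤
      l * f x₁ y₁ + (1 - l) * f x₂ y₂ - κ / 2 * l * (1 - l) * ‖x₁ - x₂‖ ^ 2

end TwoStage

end

namespace TwoStage

/-! ### Linear programming duality, vertices and linearity cones of the value function -/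

section ValueFunction

variable {s n : ℕ} {W : Matrix (Fin s) (Fin n) ℝ} {q : Fin n → ℝ}

/-! By duality `φ` is the maximum of finitely many functionals `⟪d, ·⟫`, and `q > 0` puts a ball
around `0` into the dual polyhedron, so `φ t ≥ c₀ ‖t‖`. Strong convexity along a segment follows
from second differences of order `c δ²` (`le_of_secondDiff_ge`); only the step bound on `δ`, not
`c`, may depend on the point and the direction. The second difference of the integrand is
nonnegative, so `μ` may be replaced by `r` times Lebesgue measure on `B_ρ(x)`. What remains is a
bound `c ‖a‖²` for the integral over `B_ρ(0)` of the second difference with step `(a, b)`, uniform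
in `η ≤ η₀` (`IsMaxOf.exists_le_integral_excessDiff`).

Two kinks supply it. If `η > 0`, the positive part bends across the level set `{φ = η}`. Near a
piece of this set inside the cone of `d`, the bend contributes order `(⟪d, a⟫ - b)²`, and some `d`
makes `|⟪d, a⟫ - b|` at least `c₀ ‖a‖`, whatever `b` is. The threshold condition places such pieces
inside `B_ρ(0)` (`IsMaxOf.exists_sq_le_integral_of_cell`). In dimension at least two these pieces
shrink as `η` tends to `0`. For small or nonpositive `η` the bend of `φ` itself at the origin is
used instead: on lines in direction `a` that stay above level `η`, the second differences telescope
to a change of slope of order `‖a‖` (`IsMaxOf.exists_norm_sq_le_integral`).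

Both integrals are estimated by summing translates of a ball (`mul_volume_ball_le`): about `1 / ‖a‖`
or `1 / |⟪d, a⟫ - b|` translates share a total of first order, which yields the second-order bound.
-/

lemma valueFun_le (hq : ∀ j, 0 < q j) {t : Vec s} {y : Fin n → ℝ} (hy : 0 ≤ y)
    (hW : W *ᵥ y = t.ofLp) : valueFun W q t ≤ q ⬝ᵥ y := by
  refine csInf_le ⟨0, ?_⟩ ⟨y, hy, hW, rfl⟩
  rintro c ⟨y, hy, -, rfl⟩
  exact Finset.sum_nonneg fun j _ => mul_nonneg (hq j).le (hy j)

lemma le_valueFun (hc : CompleteRecourse W) {t : Vec s} {c : ℝ}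
    (h : ∀ y : Fin n → ℝ, 0 ≤ y → W *ᵥ y = t.ofLp → c ≤ q ⬝ᵥ y) : c ≤ valueFun W q t := by
  obtain ⟨y, hy, hW⟩ := hc t
  refine le_csInf ⟨_, y, hy, hW, rfl⟩ ?_
  rintro c ⟨y, hy, hW, rfl⟩
  exact h y hy hW

lemma exists_lt_of_valueFun_lt (hc : CompleteRecourse W) {t : Vec s} {c : ℝ}
    (h : valueFun W q t < c) : ∃ y : Fin n → ℝ, 0 ≤ y ∧ W *ᵥ y = t.ofLp ∧ q ⬝ᵥ y < c := by
  by_contra! H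
  exact absurd (le_valueFun hc H) (not_le.mpr h)

lemma valueFun_nonneg (hc : CompleteRecourse W) (hq : ∀ j, 0 < q j) (t : Vec s) :
    0 ≤ valueFun W q t :=
  le_valueFun hc fun _ hy _ => Finset.sum_nonneg fun j _ => mul_nonneg (hq j).le (hy j)

lemma valueFun_zero (hc : CompleteRecourse W) (hq : ∀ j, 0 < q j) :
    valueFun W q (0 : Vec s) = 0 := by
  refine le_antisymm ?_ (valueFun_nonneg hc hq 0)
  simpa using valueFun_le (W := W) (t := 0) hq (y := 0) le_rfl (by simp)

lemma valueFun_add_le (hc : CompleteRecourse W) (hq : ∀ j, 0 < q j) (a b : Vec s) :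
    valueFun W q (a + b) ≤ valueFun W q a + valueFun W q b := by
  refine le_of_forall_pos_le_add fun ε hε => ?_
  obtain ⟨y, hy, hWy, hyq⟩ := exists_lt_of_valueFun_lt hc
    (lt_add_of_pos_right (valueFun W q a) (half_pos hε))
  obtain ⟨z, hz, hWz, hzq⟩ := exists_lt_of_valueFun_lt hc
    (lt_add_of_pos_right (valueFun W q b) (half_pos hε))
  have := valueFun_le hq (t := a + b) (add_nonneg hy hz)
    (by rw [Matrix.mulVec_add, hWy, hWz]; rfl)
  rw [dotProduct_add] at this
  linarith

lemma valueFun_smul_le (hc : CompleteRecourse W) (hq : ∀ j, 0 < q j) {c : ℝ} (hc0 : 0 < c)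
    (t : Vec s) : valueFun W q (c • t) ≤ c * valueFun W q t := by
  rw [← div_le_iff₀' hc0]
  refine le_valueFun hc fun y hy hW => ?_
  rw [div_le_iff₀' hc0]
  have := valueFun_le hq (t := c • t) (smul_nonneg hc0.le hy)
    (by rw [Matrix.mulVec_smul, hW]; rfl)
  rwa [dotProduct_smul, smul_eq_mul] at this

lemma valueFun_smul (hc : CompleteRecourse W) (hq : ∀ j, 0 < q j) {c : ℝ} (hc0 : 0 < c)
    (t : Vec s) : valueFun W q (c • t) = c * valueFun W q t := by
  refine le_antisymm (valueFun_smul_le hc hq hc0 t) ?_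
  have := valueFun_smul_le hc hq (inv_pos.mpr hc0) (c • t)
  rwa [inv_smul_smul₀ hc0.ne', ← div_eq_inv_mul, le_div_iff₀' hc0] at this

lemma inner_eq_dotProduct (v t : Vec s) : inner ℝ v t = v.ofLp ⬝ᵥ t.ofLp := by
  simp [PiLp.inner_apply, dotProduct, mul_comm]

lemma inner_le_valueFun (hc : CompleteRecourse W) {v : Vec s} (hv : v ∈ dualPolyhedron W q)
    (t : Vec s) : inner ℝ v t ≤ valueFun W q t := by
  refine le_valueFun hc fun y hy hW => ?_
  rw [inner_eq_dotProduct, ← hW, Matrix.dotProduct_mulVec, ← Matrix.mulVec_transpose]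
  exact Finset.sum_le_sum fun j _ => mul_le_mul_of_nonneg_right (hv j) (hy j)

lemma mem_dualPolyhedron_of_inner_le (hq : ∀ j, 0 < q j) {v : Vec s}
    (hv : ∀ t, inner ℝ v t ≤ valueFun W q t) : v ∈ dualPolyhedron W q := by
  intro j
  have h1 := hv (WithLp.toLp 2 (W *ᵥ Pi.single j 1))
  have h2 := valueFun_le (W := W) (t := WithLp.toLp 2 (W *ᵥ Pi.single j 1)) hq
    (y := Pi.single j 1) (by simp) rfl
  rw [inner_eq_dotProduct, Matrix.dotProduct_mulVec, ← Matrix.mulVec_transpose] at h1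
  simp at h1 h2
  linarith

/-- Strong duality for the second-stage linear program. -/
lemma exists_dual_optimal (hc : CompleteRecourse W) (hq : ∀ j, 0 < q j) (t : Vec s) :
    ∃ v ∈ dualPolyhedron W q, inner ℝ v t = valueFun W q t := by
  rcases eq_or_ne t 0 with rfl | ht
  · refine ⟨0, fun j => by simpa using (hq j).le, ?_⟩
    rw [valueFun_zero hc hq, inner_zero_left]
  -- Hahn–Banach with the sublinear majorant `φ`: the functional on the line through `t` with value
  -- `φ t` at `t` extends to one below `φ`, and such functionals are exactly the dual feasible
  -- points.
  · obtain ⟨g, hg, hle⟩ := exists_extension_of_le_sublinear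
      (LinearPMap.mkSpanSingleton t (valueFun W q t) ht) (valueFun W q)
      (fun c hc0 x => valueFun_smul hc hq hc0 x) (valueFun_add_le hc hq) (by
        rintro ⟨x, hx⟩
        obtain ⟨c, rfl⟩ := Submodule.mem_span_singleton.mp hx
        refine (LinearPMap.mkSpanSingleton'_apply (σ := RingHom.id ℝ) t _ _ c hx).trans_le ?_
        change c * _ ≤ valueFun W q (c • t)
        rcases lt_trichotomy c 0 with h | rfl | h
        · have h1 := valueFun_smul hc hq (neg_pos.mpr h) t
          have h2 := valueFun_add_le hc hq (c • t) (-c • t)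
          rw [← add_smul, add_neg_cancel, zero_smul, valueFun_zero hc hq] at h2
          linarith
        · simpa using valueFun_nonneg hc hq _
        · exact (valueFun_smul hc hq h t).ge)
    set v := (InnerProductSpace.toDual ℝ (Vec s)).symm (LinearMap.toContinuousLinearMap g)
    have hv : ∀ x, inner ℝ v x = g x := fun x => by
      simp [v, InnerProductSpace.toDual_symm_apply]
    refine ⟨v, mem_dualPolyhedron_of_inner_le hq fun x => (hv x).trans_le (hle x), ?_⟩
    rw [hv]
    have := hg ⟨t, Submodule.mem_span_singleton_self t⟩
    rwa [LinearPMap.mkSpanSingleton_apply] at this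

lemma continuous_dual_apply (j : Fin n) :
    Continuous fun v : Vec s => (Wᵀ *ᵥ v.ofLp) j := by
  simp only [Matrix.mulVec, dotProduct]
  fun_prop

lemma isClosed_dualPolyhedron : IsClosed (dualPolyhedron W q) := by
  simp only [dualPolyhedron, Set.ofPred_forall]
  exact isClosed_iInter fun j => isClosed_le (continuous_dual_apply j) continuous_const

/-- Weak duality tested at `±eᵢ` bounds every coordinate from both sides. -/
lemma exists_norm_le_of_mem_dualPolyhedron (hc : CompleteRecourse W) :
    ∃ C : ℝ, 0 < C ∧ ∀ v ∈ dualPolyhedron W q, ‖v‖ ≤ C := by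
  let B : ℝ := ∑ i, (|valueFun W q (EuclideanSpace.single i 1)| +
    |valueFun W q (EuclideanSpace.single i (-1))|)
  refine ⟨B + 1, by positivity, fun v hv => ?_⟩
  have hi : ∀ i, ‖v i‖ ≤ |valueFun W q (EuclideanSpace.single i 1)| +
      |valueFun W q (EuclideanSpace.single i (-1))| := by
    intro i
    have h1 := inner_le_valueFun hc hv (EuclideanSpace.single i 1)
    have h2 := inner_le_valueFun hc hv (EuclideanSpace.single i (-1))
    simp [EuclideanSpace.inner_single_right] at h1 h2
    rw [Real.norm_eq_abs, abs_le]
    constructor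
    · have := le_abs_self (valueFun W q (EuclideanSpace.single i (-1)))
      have := abs_nonneg (valueFun W q (EuclideanSpace.single i 1))
      linarith
    · have := le_abs_self (valueFun W q (EuclideanSpace.single i 1))
      have := abs_nonneg (valueFun W q (EuclideanSpace.single i (-1)))
      linarith
  have hv' : v = ∑ i, v i • EuclideanSpace.single i (1 : ℝ) := by
    ext j
    simp [Pi.single_apply]
  calc ‖v‖ = ‖∑ i, v i • EuclideanSpace.single i (1 : ℝ)‖ := by rw [← hv']
    _ ≤ ∑ i, ‖v i • EuclideanSpace.single i (1 : ℝ)‖ := norm_sum_le _ _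
    _ ≤ B := Finset.sum_le_sum fun i _ => by simpa [norm_smul] using hi i
    _ ≤ B + 1 := by linarith

lemma isCompact_dualPolyhedron (hc : CompleteRecourse W) : IsCompact (dualPolyhedron W q) := by
  obtain ⟨C, -, hC⟩ := exists_norm_le_of_mem_dualPolyhedron (q := q) hc
  exact Metric.isCompact_of_isClosed_isBounded isClosed_dualPolyhedron
    (isBounded_iff_forall_norm_le.mpr ⟨C, hC⟩)

/-- The optimal dual points form a nonempty compact exposed face; an extreme point of this face is a
vertex of the polyhedron. -/
lemma exists_dualVertex_optimal (hc : CompleteRecourse W) (hq : ∀ j, 0 < q j) (t : Vec s) :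
    ∃ d ∈ dualVertices W q, inner ℝ d t = valueFun W q t := by
  obtain ⟨v, hv, hvt⟩ := exists_dual_optimal hc hq t
  have hexp : IsExposed ℝ (dualPolyhedron W q)
      {x ∈ dualPolyhedron W q | ∀ y ∈ dualPolyhedron W q, innerSL ℝ t y ≤ innerSL ℝ t x} :=
    fun _ => ⟨innerSL ℝ t, rfl⟩
  have hle : ∀ y ∈ dualPolyhedron W q, innerSL ℝ t y ≤ valueFun W q t := fun y hy => by
    rw [innerSL_apply_apply, real_inner_comm]
    exact inner_le_valueFun hc hy t
  have hvt' : innerSL ℝ t v = valueFun W q t := by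
    rw [innerSL_apply_apply, real_inner_comm, hvt]
  obtain ⟨d, hd⟩ := (hexp.isCompact (isCompact_dualPolyhedron hc)).extremePoints_nonempty
    ⟨v, hv, fun y hy => (hle y hy).trans hvt'.ge⟩
  refine ⟨d, hexp.isExtreme.extremePoints_subset_extremePoints hd,
    le_antisymm (inner_le_valueFun hc hd.1.1 t) ?_⟩
  have := hd.1.2 v hv
  rwa [hvt', innerSL_apply_apply, real_inner_comm] at this

/-- A vertex is determined by its set of active constraints. -/
lemma dualVertices_finite : (dualVertices W q).Finite := by
  refine Set.Finite.of_injOn (f := fun v : Vec s => {j | (Wᵀ *ᵥ v.ofLp) j = q j})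
    (t := Set.univ) (fun _ _ => Set.mem_univ _) ?_ Set.finite_univ
  intro v hv v' hv' hvv
  have hact : ∀ j, (Wᵀ *ᵥ v.ofLp) j = q j → (Wᵀ *ᵥ v'.ofLp) j = q j := fun j hj => by
    have h : j ∈ {j | (Wᵀ *ᵥ v.ofLp) j = q j} := hj
    exact (Set.ext_iff.mp hvv j).mp h
  -- With equal active sets, the segment from `v'` to `v` can be prolonged slightly beyond `v`:
  -- slack constraints survive by continuity, active ones are constant along the line. Extremality
  -- of `v` then forces `v = v'`.
  have hev : ∀ᶠ ε : ℝ in nhdsWithin 0 (Set.Ioi 0), ∀ j,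
      (Wᵀ *ᵥ (v + ε • (v - v')).ofLp) j ≤ q j := by
    refine Filter.eventually_all.mpr fun j => ?_
    rcases (hv.1 j).lt_or_eq with h | h
    · have hcont : Continuous fun ε : ℝ => (Wᵀ *ᵥ (v + ε • (v - v')).ofLp) j :=
        (continuous_dual_apply j).comp (by fun_prop)
      have := hcont.tendsto 0
      simp only [zero_smul, add_zero] at this
      exact ((this.eventually (gt_mem_nhds h)).mono fun _ h => h.le).filter_mono
        nhdsWithin_le_nhds
    · refine Filter.Eventually.of_forall fun ε => ?_
      simp [Matrix.mulVec_add, Matrix.mulVec_smul, Matrix.mulVec_sub, h, hact j h]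
  obtain ⟨ε, hε, hε0⟩ := (hev.and self_mem_nhdsWithin).exists
  have hε0 : 0 < ε := hε0
  have hmem : v ∈ openSegment ℝ v' (v + ε • (v - v')) := by
    refine ⟨ε / (1 + ε), 1 / (1 + ε), by positivity, by positivity, by field_simp; ring, ?_⟩
    have : (1 + ε) ≠ 0 := by positivity
    ext i
    simp
    field_simp
    ring
  exact (hv.2 hv'.1 hε hmem).symm

lemma exists_mul_norm_le_valueFun (hc : CompleteRecourse W) (hq : ∀ j, 0 < q j) :
    ∃ c : ℝ, 0 < c ∧ ∀ t : Vec s, c * ‖t‖ ≤ valueFun W q t := by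
  have hnhds : ∀ᶠ v in nhds (0 : Vec s), ∀ j, (Wᵀ *ᵥ v.ofLp) j ≤ q j := by
    refine Filter.eventually_all.mpr fun j => ?_
    have := (continuous_dual_apply (W := W) j).tendsto 0
    simp only [WithLp.ofLp_zero, Matrix.mulVec_zero, Pi.zero_apply] at this
    exact (this.eventually (gt_mem_nhds (hq j))).mono fun _ h => h.le
  obtain ⟨ε, hε, hball⟩ := Metric.eventually_nhds_iff.mp hnhds
  refine ⟨ε / 2, by positivity, fun t => ?_⟩
  rcases eq_or_ne t 0 with rfl | ht
  · simpa using valueFun_nonneg hc hq 0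
  have ht' : 0 < ‖t‖ := norm_pos_iff.mpr ht
  have hv : (ε / 2 / ‖t‖) • t ∈ dualPolyhedron W q := by
    refine @hball _ ?_
    rw [dist_zero_right, norm_smul, Real.norm_eq_abs, abs_of_pos (by positivity),
      div_mul_cancel₀ _ ht'.ne']
    linarith
  have := inner_le_valueFun hc hv t
  rw [real_inner_smul_left, real_inner_self_eq_norm_sq] at this
  convert this using 1
  field_simp

lemma mem_vertexCone_iff (hc : CompleteRecourse W) (hq : ∀ j, 0 < q j) {d : Vec s}
    (hd : d ∈ dualVertices W q) (z : Vec s) :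
    z ∈ vertexCone W q d ↔ inner ℝ d z = valueFun W q z := by
  constructor
  · intro h
    obtain ⟨d', hd', h'⟩ := exists_dualVertex_optimal hc hq z
    have := h d' hd'
    rw [inner_sub_left] at this
    exact le_antisymm (inner_le_valueFun hc hd.1 z) (by linarith)
  · intro h d' hd'
    have := inner_le_valueFun hc hd'.1 z
    rw [inner_sub_left]
    linarith

lemma isClosed_vertexCone (d : Vec s) : IsClosed (vertexCone W q d) := by
  simp only [vertexCone, Set.ofPred_forall]
  exact isClosed_biInter fun d' _ => isClosed_le continuous_const (by fun_prop)

lemma convex_vertexCone (d : Vec s) : Convex ℝ (vertexCone W q d) := by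
  intro x hx y hy a b ha hb _ d' hd'
  rw [inner_add_right, real_inner_smul_right, real_inner_smul_right]
  exact add_nonneg (mul_nonneg ha (hx d' hd')) (mul_nonneg hb (hy d' hd'))

lemma smul_mem_vertexCone {d z : Vec s} (hz : z ∈ vertexCone W q d) {c : ℝ} (hc : 0 ≤ c) :
    c • z ∈ vertexCone W q d := fun d' hd' => by
  rw [real_inner_smul_right]
  exact mul_nonneg hc (hz d' hd')

/-- Since `φ ≥ 0`, the restriction `dᵀ z ≥ 0` cuts nothing off `K_d`. Since `φ` vanishes only at
`0`, the cone of a zero vertex would lie in `{0}`, which has empty interior when `s > 0`. -/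
lemma mem_positiveVertices (hc : CompleteRecourse W) (hq : ∀ j, 0 < q j) (hs : 0 < s)
    {d : Vec s} (hd : d ∈ dualVertices W q) (hint : (interior (vertexCone W q d)).Nonempty) :
    d ∈ positiveVertices W q := by
  refine ⟨hd, ?_, ?_⟩
  · rintro rfl
    have : Nonempty (Fin s) := ⟨⟨0, hs⟩⟩
    obtain ⟨c, hc0, hcφ⟩ := exists_mul_norm_le_valueFun hc hq
    have hsub : vertexCone W q 0 ⊆ {0} := fun z hz => by
      rw [mem_vertexCone_iff hc hq hd, inner_zero_left] at hz
      have := hcφ z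
      rw [← hz] at this
      have : ‖z‖ ≤ 0 := by nlinarith [norm_nonneg z]
      simpa using this
    obtain ⟨z, hz⟩ := hint
    have := interior_mono hsub hz
    rw [interior_singleton] at this
    exact this
  · convert hint using 2
    refine Set.inter_eq_left.mpr fun z hz => ?_
    rw [mem_vertexCone_iff hc hq hd] at hz
    exact (valueFun_nonneg hc hq z).trans hz.ge

/-- The finitely many closed cones with empty interior have a dense common complement, so they
cannot cover the open set left over by the full-dimensional cones. Hence the full-dimensional cones
already cover the space. -/
lemma exists_positiveVertex_optimal (hc : CompleteRecourse W) (hq : ∀ j, 0 < q j) (hs : 0 < s)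
    (t : Vec s) : ∃ d ∈ positiveVertices W q, inner ℝ d t = valueFun W q t := by
  by_contra! H
  let N : Set (Vec s) := {d | d ∈ dualVertices W q ∧ interior (vertexCone W q d) = ∅}
  have hdense : Dense (⋂ d ∈ N, (vertexCone W q d)ᶜ) :=
    dense_biInter_of_isOpen (fun d _ => (isClosed_vertexCone d).isOpen_compl)
      (dualVertices_finite.subset fun d hd => hd.1).countable
      (fun d hd => interior_eq_empty_iff_dense_compl.mp hd.2)
  have hfin : (positiveVertices W q).Finite := dualVertices_finite.subset fun d hd => hd.1
  have hopen : IsOpen (⋂ d ∈ positiveVertices W q, (vertexCone W q d)ᶜ) :=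
    hfin.isOpen_biInter fun d _ => (isClosed_vertexCone d).isOpen_compl
  obtain ⟨z, hz1, hz2⟩ := hdense.inter_open_nonempty _ hopen ⟨t, by
    simp only [Set.mem_iInter, Set.mem_compl_iff]
    intro d hd h
    exact H d hd ((mem_vertexCone_iff hc hq hd.1 t).mp h)⟩
  simp only [Set.mem_iInter, Set.mem_compl_iff] at hz1 hz2
  obtain ⟨d, hd, hdz⟩ := exists_dualVertex_optimal hc hq z
  rw [← mem_vertexCone_iff hc hq hd] at hdz
  rcases Set.eq_empty_or_nonempty (interior (vertexCone W q d)) with h | h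
  · exact hz2 d ⟨hd, h⟩ hdz
  · exact hz1 d (mem_positiveVertices hc hq hs hd h) hdz

/-- Below an admissible threshold, each cone of a positive vertex contains a ball inside
`B_ρ(0)` centred on the hyperplane of level `η₀`. -/
lemma AdmissibleThreshold.exists_ball_subset (hc : CompleteRecourse W) (hq : ∀ j, 0 < q j)
    {ρ η₀ : ℝ} (h : AdmissibleThreshold W q ρ η₀) {d : Vec s} (hd : d ∈ positiveVertices W q) :
    ∃ (p : Vec s) (β : ℝ), 0 < β ∧ inner ℝ d p = η₀ ∧
      Metric.ball p (3 * β) ⊆ Metric.ball 0 ρ ∩ {z | inner ℝ d z = valueFun W q z} := by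
  obtain ⟨hη, hray⟩ := h
  obtain ⟨y, ⟨hy, t, -, ht, hyt⟩, hyρ⟩ := hray d hd
  have hyK : y ∈ vertexCone W q d := ht.subset hyt
  obtain ⟨hdv, hd0, z, hz⟩ := hd
  replace hz : z ∈ interior (vertexCone W q d) := interior_mono Set.inter_subset_left hz
  -- An interior point can be moved to `z - ε d` within the cone, where `⟪d, ·⟫ = φ ≥ 0`; the move
  -- lowers the value by `ε ‖d‖² > 0`.
  have hzpos : 0 < inner ℝ d z := by
    have hcont : Continuous fun ε : ℝ => z - ε • d := by fun_prop
    have h1 : ∀ᶠ ε : ℝ in nhdsWithin 0 (Set.Ioi 0), z - ε • d ∈ interior (vertexCone W q d) := by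
      refine (hcont.tendsto 0).eventually ?_ |>.filter_mono nhdsWithin_le_nhds
      simpa using isOpen_interior.mem_nhds hz
    obtain ⟨ε, hε, hε0⟩ := (h1.and self_mem_nhdsWithin).exists
    have hε0 : 0 < ε := hε0
    have h2 := (mem_vertexCone_iff hc hq hdv _).mp (interior_subset hε)
    have h3 := valueFun_nonneg hc hq (z - ε • d)
    rw [← h2, inner_sub_right, real_inner_smul_right, real_inner_self_eq_norm_sq] at h3
    have : 0 < ε * ‖d‖ ^ 2 := by have := norm_pos_iff.mpr hd0; positivity
    linarith
  -- Starting at the ray point `y`, this path stays on the level-`η₀` hyperplane and enters the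
  -- interior of the cone at once; for small `l` it is still inside `B_ρ(0)`.
  let p : ℝ → Vec s := fun l => (1 - l) • y + l • ((η₀ / inner ℝ d z) • z)
  have hpcont : Continuous p := by fun_prop
  have h1 : ∀ᶠ l : ℝ in nhdsWithin 0 (Set.Ioi 0), ‖p l‖ < ρ := by
    refine (hpcont.norm.tendsto 0).eventually (gt_mem_nhds ?_) |>.filter_mono nhdsWithin_le_nhds
    simpa [p] using hyρ
  have h2 : ∀ᶠ l : ℝ in nhdsWithin 0 (Set.Ioi 0), l < 1 :=
    (gt_mem_nhds one_pos).filter_mono nhdsWithin_le_nhds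
  obtain ⟨l, ⟨hl1, hl2⟩, hl0⟩ := ((h1.and h2).and self_mem_nhdsWithin).exists
  have hl0 : 0 < l := hl0
  have hz' : (η₀ / inner ℝ d z) • z ∈ interior (vertexCone W q d) := by
    have hpos : 0 < η₀ / inner ℝ d z := by positivity
    have hsub : (η₀ / inner ℝ d z) • vertexCone W q d ⊆ vertexCone W q d := by
      rintro _ ⟨w, hw, rfl⟩
      exact smul_mem_vertexCone hw hpos.le
    refine interior_mono hsub ?_
    rw [interior_smul₀ hpos.ne']
    exact Set.smul_mem_smul_set hz
  have hpint : p l ∈ interior (vertexCone W q d) :=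
    (convex_vertexCone d).combo_self_interior_mem_interior hyK hz' (by linarith) hl0 (by ring)
  have hmem : Metric.ball 0 ρ ∩ interior (vertexCone W q d) ∈ nhds (p l) :=
    (Metric.isOpen_ball.inter isOpen_interior).mem_nhds ⟨by simpa using hl1, hpint⟩
  obtain ⟨ε, hε, hsub⟩ := Metric.mem_nhds_iff.mp hmem
  refine ⟨p l, ε / 3, by positivity, ?_, ?_⟩
  · simp only [p, inner_add_right, real_inner_smul_right, hy]
    field_simp
    ring
  · rw [mul_div_cancel₀ _ three_ne_zero]
    exact fun w hw => ⟨(hsub hw).1, (mem_vertexCone_iff hc hq hdv w).mp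
      (interior_subset (hsub hw).2)⟩

end ValueFunction

/-! ### Second differences of the excess of a maximum of linear functionals -/

section SupportFunction

variable {E : Type*} [NormedAddCommGroup E]

/-- The excess `max {0, φ(y) - η}` of `φ` over the level `η`. -/
def excessOver (φ : E → ℝ) (η : ℝ) (y : E) : ℝ :=
  max 0 (φ y - η)

/-- The symmetric second difference of the excess at `(y, η)` with step `(a, b)`. -/
def excessDiff (φ : E → ℝ) (a : E) (b η : ℝ) (y : E) : ℝ :=
  excessOver φ (η + b) (y + a) + excessOver φ (η - b) (y - a) - 2 * excessOver φ η y

variable {φ : E → ℝ}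

lemma continuous_excessOver (hφ : Continuous φ) (η : ℝ) : Continuous (excessOver φ η) := by
  unfold excessOver
  fun_prop

lemma continuous_excessDiff (hφ : Continuous φ) (a : E) (b η : ℝ) :
    Continuous (excessDiff φ a b η) := by
  unfold excessDiff excessOver
  fun_prop

/-- Above the level `η`, the second difference of the excess dominates that of `φ`. -/
lemma le_excessDiff_of_le {η : ℝ} {y : E} (hy : η ≤ φ y) (a : E) (b : ℝ) :
    φ (y + a) + φ (y - a) - 2 * φ y ≤ excessDiff φ a b η y := by
  unfold excessDiff excessOver
  have h2 := le_max_right 0 (φ (y + a) - (η + b))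
  have h4 := le_max_right 0 (φ (y - a) - (η - b))
  rw [max_eq_right (a := 0) (b := φ y - η) (by linarith)]
  linarith

variable [InnerProductSpace ℝ E]

/-- `φ` is the pointwise maximum of the linear functionals `⟪d, ·⟫`, `d ∈ D`. -/
structure IsMaxOf (φ : E → ℝ) (D : Set E) : Prop where
  inner_le : ∀ d ∈ D, ∀ t, inner ℝ d t ≤ φ t
  exists_eq : ∀ t, ∃ d ∈ D, inner ℝ d t = φ t

variable {D : Set E} {C c₀ : ℝ}

lemma IsMaxOf.sub_le (h : IsMaxOf φ D) (hC : ∀ d ∈ D, ‖d‖ ≤ C) (x y : E) :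
    φ x - φ y ≤ C * ‖x - y‖ := by
  obtain ⟨d, hd, hdx⟩ := h.exists_eq x
  have h1 := h.inner_le d hd y
  have h2 := real_inner_le_norm d (x - y)
  have h3 := mul_le_mul_of_nonneg_right (hC d hd) (norm_nonneg (x - y))
  rw [inner_sub_right] at h2
  linarith

lemma IsMaxOf.abs_sub_le (h : IsMaxOf φ D) (hC : ∀ d ∈ D, ‖d‖ ≤ C) (x y : E) :
    |φ x - φ y| ≤ C * ‖x - y‖ := by
  rw [abs_sub_le_iff]
  exact ⟨h.sub_le hC x y, by rw [norm_sub_rev]; exact h.sub_le hC y x⟩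

lemma IsMaxOf.continuous (h : IsMaxOf φ D) (hC0 : 0 ≤ C) (hC : ∀ d ∈ D, ‖d‖ ≤ C) :
    Continuous φ := by
  refine (LipschitzWith.of_dist_le_mul (K := ⟨C, hC0⟩) fun x y => ?_).continuous
  rw [Real.dist_eq, dist_eq_norm]
  exact h.abs_sub_le hC x y

lemma IsMaxOf.smul (h : IsMaxOf φ D) {c : ℝ} (hc : 0 ≤ c) (x : E) : φ (c • x) = c * φ x := by
  refine le_antisymm ?_ ?_
  · obtain ⟨d, hd, hdx⟩ := h.exists_eq (c • x)
    rw [← hdx, real_inner_smul_right]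
    exact mul_le_mul_of_nonneg_left (h.inner_le d hd x) hc
  · obtain ⟨d, hd, hdx⟩ := h.exists_eq x
    rw [← hdx, ← real_inner_smul_right]
    exact h.inner_le d hd _

lemma IsMaxOf.two_mul_le (h : IsMaxOf φ D) (y a : E) : 2 * φ y ≤ φ (y + a) + φ (y - a) := by
  obtain ⟨d, hd, hdy⟩ := h.exists_eq y
  have h1 := h.inner_le d hd (y + a)
  have h2 := h.inner_le d hd (y - a)
  rw [inner_add_right] at h1
  rw [inner_sub_right] at h2
  linarith

/-- This is joint midpoint convexity of `max {0, φ(y) - η}` in `(y, η)`. It permits discarding parts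
of the domain of integration later. -/
lemma IsMaxOf.excessDiff_nonneg (h : IsMaxOf φ D) (a : E) (b η : ℝ) (y : E) :
    0 ≤ excessDiff φ a b η y := by
  have h0 := h.two_mul_le y a
  unfold excessDiff excessOver
  have h1 := le_max_left 0 (φ (y + a) - (η + b))
  have h2 := le_max_right 0 (φ (y + a) - (η + b))
  have h3 := le_max_left 0 (φ (y - a) - (η - b))
  have h4 := le_max_right 0 (φ (y - a) - (η - b))
  rcases max_cases 0 (φ y - η) with h | h <;> linarith

lemma IsMaxOf.abs_excessOver_sub_le (h : IsMaxOf φ D) (hC : ∀ d ∈ D, ‖d‖ ≤ C) (x y : E)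
    (η η' : ℝ) : |excessOver φ η x - excessOver φ η' y| ≤ C * ‖x - y‖ + |η - η'| := by
  unfold excessOver
  rw [max_comm 0, max_comm 0]
  refine (abs_max_sub_max_le_abs _ _ _).trans ?_
  rw [show φ x - η - (φ y - η') = (φ x - φ y) - (η - η') by ring]
  exact (abs_sub _ _).trans (add_le_add_left (h.abs_sub_le hC x y) _)

/-- Near the level set `{φ = η}` inside a linearity region of `φ`, the second difference is that
of the positive part. -/
lemma IsMaxOf.abs_sub_abs_le_excessDiff (h : IsMaxOf φ D) {d : E} (hd : d ∈ D) {y : E}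
    (hy : inner ℝ d y = φ y) (a : E) (b η : ℝ) :
    |inner ℝ d a - b| - |inner ℝ d y - η| ≤ excessDiff φ a b η y := by
  have h1 := h.inner_le d hd (y + a)
  have h2 := h.inner_le d hd (y - a)
  rw [inner_add_right] at h1
  rw [inner_sub_right] at h2
  unfold excessDiff excessOver
  have h3 := le_max_left 0 (φ (y + a) - (η + b))
  have h4 := le_max_right 0 (φ (y + a) - (η + b))
  have h5 := le_max_left 0 (φ (y - a) - (η - b))
  have h6 := le_max_right 0 (φ (y - a) - (η - b))
  rcases max_cases 0 (φ y - η) with h7 | h7 <;> rcases abs_cases (inner ℝ d a - b) with h8 | h8 <;>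
    rcases abs_cases (inner ℝ d y - η) with h9 | h9 <;> linarith

/-- Far out in direction `g`, the function `φ` increases with slope at least `c₀ / 2`. -/
lemma IsMaxOf.mul_norm_le_sub (h : IsMaxOf φ D) (hC : ∀ d ∈ D, ‖d‖ ≤ C) (hc₀ : 0 < c₀)
    (hφ : ∀ t, c₀ * ‖t‖ ≤ φ t) {y g : E} {K T : ℝ} (hT : 0 < T)
    (hK : T ≤ K * ‖g‖) (hy : (c₀ + C) * ‖y‖ ≤ c₀ * T / 2) :
    c₀ * ‖g‖ / 2 ≤ φ (y + (K + 1) • g) - φ (y + K • g) := by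
  have hg : 0 < ‖g‖ := by
    refine (norm_nonneg g).lt_of_ne fun h => ?_
    rw [← h, mul_zero] at hK
    linarith
  have hK0 : 0 < K := pos_of_mul_pos_left (hT.trans_le hK) hg.le
  obtain ⟨d, hd, hdz⟩ := h.exists_eq (y + K • g)
  have h1 := h.inner_le d hd (y + (K + 1) • g)
  have h2 : K * ‖g‖ - ‖y‖ ≤ ‖y + K • g‖ := by
    have := norm_sub_le (y + K • g) y
    rw [add_sub_cancel_left, norm_smul, Real.norm_eq_abs, abs_of_pos hK0] at this
    linarith
  have h3 := (mul_le_mul_of_nonneg_left h2 hc₀.le).trans (hφ _)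
  have h4 := (real_inner_le_norm d y).trans
    (mul_le_mul_of_nonneg_right (hC d hd) (norm_nonneg y))
  rw [← hdz, inner_add_right, real_inner_smul_right] at h3
  rw [inner_add_right, real_inner_smul_right] at h1 hdz
  -- Growth of `φ` at `y + K g` gives `K ⟪d, g⟫ ≥ c₀ K ‖g‖ - (c₀ + C) ‖y‖`, and the subtracted term
  -- is at most `c₀ T / 2 ≤ c₀ K ‖g‖ / 2`.
  have h5 : c₀ * ‖g‖ / 2 * K ≤ inner ℝ d g * K := by
    have := mul_le_mul_of_nonneg_left hK hc₀.le
    nlinarith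
  have := le_of_mul_le_mul_right h5 hK0
  linarith

/-- The second differences of `φ` along a long segment through a neighbourhood of the origin
telescope to a difference of slopes. -/
lemma IsMaxOf.mul_norm_le_sum (h : IsMaxOf φ D) (hC : ∀ d ∈ D, ‖d‖ ≤ C) (hc₀ : 0 < c₀)
    (hφ : ∀ t, c₀ * ‖t‖ ≤ φ t) {y g : E} {K : ℕ} {T : ℝ} (hT : 0 < T)
    (hK : T ≤ K * ‖g‖) (hy : (c₀ + C) * ‖y‖ ≤ c₀ * T / 2) :
    c₀ * ‖g‖ ≤ ∑ j ∈ Finset.range (2 * K + 1),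
      (φ (y + ((j : ℝ) - K) • g + g) + φ (y + ((j : ℝ) - K) • g - g)
        - 2 * φ (y + ((j : ℝ) - K) • g)) := by
  let u : ℕ → ℝ := fun j => φ (y + ((j : ℝ) - K - 1) • g)
  have hsum : ∑ j ∈ Finset.range (2 * K + 1),
      (φ (y + ((j : ℝ) - K) • g + g) + φ (y + ((j : ℝ) - K) • g - g)
        - 2 * φ (y + ((j : ℝ) - K) • g)) =
      ∑ j ∈ Finset.range (2 * K + 1), ((u (j + 1 + 1) - u (j + 1)) - (u (j + 1) - u j)) := by
    refine Finset.sum_congr rfl fun j _ => ?_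
    have e1 : y + ((j : ℝ) - K) • g + g = y + (((j + 1 + 1 : ℕ) : ℝ) - K - 1) • g := by
      push_cast; module
    have e2 : y + ((j : ℝ) - K) • g - g = y + ((j : ℝ) - K - 1) • g := by module
    have e3 : y + ((j : ℝ) - K) • g = y + (((j + 1 : ℕ) : ℝ) - K - 1) • g := by
      push_cast; module
    rw [e1, e2, e3]
    ring
  rw [hsum, Finset.sum_range_sub (fun j => u (j + 1) - u j)]
  have h1 := h.mul_norm_le_sub hC hc₀ hφ hT hK hy
  -- The slope at the far end in direction `-g` supplies the other half of `c₀ ‖g‖`.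
  have h2 := h.mul_norm_le_sub hC hc₀ hφ (y := y) (g := -g) hT (by rwa [norm_neg]) hy
  rw [norm_neg] at h2
  have e1 : u (2 * K + 1 + 1) = φ (y + ((K : ℝ) + 1) • g) := by
    simp only [u]; congr 1; push_cast; module
  have e2 : u (2 * K + 1) = φ (y + (K : ℝ) • g) := by
    simp only [u]; congr 1; push_cast; module
  have e3 : u (0 + 1) = φ (y + (K : ℝ) • -g) := by
    simp only [u]; congr 1; push_cast; module
  have e4 : u 0 = φ (y + ((K : ℝ) + 1) • -g) := by
    simp only [u]; congr 1; push_cast; module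
  rw [e1, e2, e3, e4]
  linarith

/-! ### Integral estimates by summing translates of a ball -/

variable [FiniteDimensional ℝ E] [MeasurableSpace E] [BorelSpace E]

/-- If the sum of translates of `f` is at least `σ` on a ball, and all translates of that ball
stay in `B_ρ(0)`, then `f` has a large integral over `B_ρ(0)`. -/
lemma mul_volume_ball_le {ι : Type*} (I : Finset ι) (w : ι → E) {f : E → ℝ} (hf : Continuous f)
    (hf0 : ∀ y, 0 ≤ f y) {p : E} {β ρ σ : ℝ}
    (hw : ∀ i ∈ I, ∀ y ∈ Metric.ball p β, y + w i ∈ Metric.ball (0 : E) ρ)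
    (hσ : ∀ y ∈ Metric.ball p β, σ ≤ ∑ i ∈ I, f (y + w i)) :
    σ * volume.real (Metric.ball p β) ≤ I.card * ∫ y in Metric.ball (0 : E) ρ, f y := by
  have hint : ∀ {g : E → ℝ}, Continuous g → ∀ x R, IntegrableOn g (Metric.ball x R) volume :=
    fun hg x R => (hg.locallyIntegrable.integrableOn_isCompact
      (isCompact_closedBall x R)).mono_set Metric.ball_subset_closedBall
  calc σ * volume.real (Metric.ball p β) = ∫ _ in Metric.ball p β, σ := by
        rw [setIntegral_const, smul_eq_mul, mul_comm]
    _ ≤ ∫ y in Metric.ball p β, ∑ i ∈ I, f (y + w i) :=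
        setIntegral_mono_on (hint continuous_const _ _) (hint (by fun_prop) _ _)
          measurableSet_ball hσ
    _ = ∑ i ∈ I, ∫ y in Metric.ball p β, f (y + w i) :=
        integral_finsetSum _ fun i _ => hint (by fun_prop) _ _
    _ ≤ ∑ i ∈ I, ∫ y in Metric.ball (0 : E) ρ, f y := by
        refine Finset.sum_le_sum fun i hi => ?_
        have hmp := measurePreserving_add_right (volume : Measure E) (w i)
        rw [← hmp.setIntegral_preimage_emb (measurableEmbedding_addRight (w i)) f]
        refine setIntegral_mono_set ?_ (ae_of_all _ fun y => hf0 _)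
          (LE.le.eventuallyLE fun y hy => hw i hi y hy)
        exact (hmp.integrableOn_comp_preimage (measurableEmbedding_addRight (w i))).mpr
          (hint hf _ _)
    _ = I.card * ∫ y in Metric.ball (0 : E) ρ, f y := by
        rw [Finset.sum_const, nsmul_eq_mul]

/-- Put `α = |⟪d, a⟫ - b|` and translate the ball along `d` so that `⟪d, ·⟫` changes in steps of
`α`. Every `y` has a translate within `α / 2` of the level `η`, where the second difference is at
least `α / 2`. The number of translates is of order `‖d‖ β / α`, hence the square of `α`. -/
lemma IsMaxOf.mul_volume_le_of_ball_subset (h : IsMaxOf φ D) (hφ : Continuous φ) {d : E}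
    (hd : d ∈ D) {p : E} {β ρ η : ℝ} (hp : inner ℝ d p = η)
    (hsub : Metric.ball p (3 * β) ⊆ Metric.ball 0 ρ ∩ {z | inner ℝ d z = φ z})
    {a : E} {b : ℝ} (hα : 0 < |inner ℝ d a - b|) (hαβ : |inner ℝ d a - b| ≤ β * ‖d‖ / 2) :
    (inner ℝ d a - b) ^ 2 * volume.real (Metric.ball p β) ≤
      10 * ‖d‖ * β * ∫ y in Metric.ball (0 : E) ρ, excessDiff φ a b η y := by
  rw [← sq_abs]
  set α := |inner ℝ d a - b| with hαdef
  have hβd : 0 < β * ‖d‖ := by linarith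
  have hd0 : 0 < ‖d‖ := (norm_nonneg d).lt_of_ne fun h => by simp [← h] at hβd
  have hβ : 0 < β := pos_of_mul_pos_left hβd hd0.le
  -- The extra `1` leaves room for rounding `-x / α`. Since `2 α ≤ ‖d‖ β`, shifts of up to `M` steps
  -- have length at most `2 β`, so the translates stay in the ball of radius `3 β`.
  set M : ℕ := ⌈‖d‖ * β / α⌉₊ + 1
  have hM1 : ‖d‖ * β / α + 1 ≤ M := by
    push_cast [M]; linarith [Nat.le_ceil (‖d‖ * β / α)]
  have hM2 : (M : ℝ) ≤ ‖d‖ * β / α + 2 := by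
    push_cast [M]; linarith [Nat.ceil_lt_add_one (show 0 ≤ ‖d‖ * β / α by positivity)]
  have hM3 : M * α ≤ ‖d‖ * β + 2 * α := by
    have := mul_le_mul_of_nonneg_right hM2 hα.le
    rwa [add_mul, div_mul_cancel₀ _ hα.ne'] at this
  let w : ℤ → E := fun m => (m * α / ‖d‖ ^ 2) • d
  have hwmem : ∀ m ∈ Finset.Icc (-M : ℤ) M, ∀ y ∈ Metric.ball p β,
      y + w m ∈ Metric.ball p (3 * β) := by
    intro m hm y hy
    rw [Finset.mem_Icc] at hm
    have hm' : |(m : ℝ)| ≤ M := by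
      rw [abs_le]; exact ⟨by exact_mod_cast hm.1, by exact_mod_cast hm.2⟩
    have hwn : ‖w m‖ ≤ 2 * β := by
      simp only [w]
      rw [norm_smul, norm_div, norm_mul, norm_pow, norm_norm, Real.norm_eq_abs, Real.norm_eq_abs,
        abs_of_pos hα]
      rw [show |(m : ℝ)| * α / ‖d‖ ^ 2 * ‖d‖ = |(m : ℝ)| * α / ‖d‖ by field_simp,
        div_le_iff₀ hd0]
      have := mul_le_mul_of_nonneg_right hm' hα.le
      linarith
    rw [Metric.mem_ball, dist_eq_norm] at hy ⊢
    calc ‖y + w m - p‖ = ‖(y - p) + w m‖ := by congr 1; abel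
      _ ≤ ‖y - p‖ + ‖w m‖ := norm_add_le _ _
      _ < 3 * β := by linarith
  have key := mul_volume_ball_le (Finset.Icc (-M : ℤ) M) w (continuous_excessDiff hφ a b η)
    (h.excessDiff_nonneg a b η) (p := p) (β := β) (ρ := ρ) (σ := α / 2)
    (fun m hm y hy => (hsub (hwmem m hm y hy)).1) (by
      intro y hy
      set x := inner ℝ d y - η
      have hx : |x| ≤ ‖d‖ * β := by
        rw [show x = inner ℝ d (y - p) by rw [inner_sub_right, hp]]
        rw [Metric.mem_ball, dist_eq_norm] at hy
        exact (abs_real_inner_le_norm d (y - p)).trans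
          (mul_le_mul_of_nonneg_left hy.le hd0.le)
      let m : ℤ := round (-x / α)
      have hr : |-x / α - m| ≤ 1 / 2 := abs_sub_round _
      have hm : m ∈ Finset.Icc (-M : ℤ) M := by
        have h1 : |-x / α| ≤ ‖d‖ * β / α := by
          rw [abs_div, abs_neg, abs_of_pos hα]
          exact div_le_div_of_nonneg_right hx hα.le
        rw [abs_le] at h1 hr
        rw [Finset.mem_Icc]
        constructor
        · have : -(M : ℝ) ≤ m := by linarith
          exact_mod_cast this
        · have : (m : ℝ) ≤ M := by linarith
          exact_mod_cast this
      refine le_trans ?_ (Finset.single_le_sum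
        (f := fun m => excessDiff φ a b η (y + w m))
        (fun m _ => h.excessDiff_nonneg a b η (y + w m)) hm)
      refine le_trans ?_ (h.abs_sub_abs_le_excessDiff hd (hsub (hwmem m hm y hy)).2 a b η)
      have e : inner ℝ d (y + w m) - η = -α * (-x / α - m) := by
        simp only [w, x]
        rw [inner_add_right, real_inner_smul_right, real_inner_self_eq_norm_sq]
        field_simp
        ring
      rw [e, abs_mul, abs_neg, abs_of_pos hα]
      have := mul_le_mul_of_nonneg_left hr hα.le
      linarith)
  have hcard : ((Finset.Icc (-M : ℤ) M).card : ℝ) = 2 * M + 1 := by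
    rw [Int.card_Icc, show (M : ℤ) + 1 - -M = ((2 * M + 1 : ℕ) : ℤ) by push_cast; ring,
      Int.toNat_natCast]
    push_cast
    rfl
  rw [hcard] at key
  set J := ∫ y in Metric.ball (0 : E) ρ, excessDiff φ a b η y
  have hJ : 0 ≤ J := integral_nonneg fun y => h.excessDiff_nonneg a b η y
  have h5 : α * (2 * M + 1) ≤ 5 * ‖d‖ * β := by nlinarith
  nlinarith [mul_le_mul_of_nonneg_right h5 hJ, mul_le_mul_of_nonneg_left key hα.le]

/-- By `hlevel` the lines in direction `a` through the ball stay above level `η`, so the excess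
bends at least as much as `φ`. Each line collects a total of `c₀ ‖a‖` from `2 K + 1 ≤ 2 ρ / ‖a‖`
steps. -/
lemma IsMaxOf.norm_sq_mul_volume_le (h : IsMaxOf φ D) (hC0 : 0 ≤ C) (hC : ∀ d ∈ D, ‖d‖ ≤ C)
    (hc₀ : 0 < c₀) (hφ : ∀ t, c₀ * ‖t‖ ≤ φ t) {p a : E} {b β ρ r₁ η : ℝ}
    (hρ : 0 < ρ) (hr₁ : (c₀ + C) * r₁ ≤ c₀ * ρ / 8) (hr₁ρ : r₁ ≤ ρ / 2)
    (hball : ∀ y ∈ Metric.ball p β, ‖y‖ ≤ r₁)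
    (hlevel : ∀ y ∈ Metric.ball p β, ∀ t : ℝ, η ≤ φ (y + t • a))
    (ha : a ≠ 0) (haρ : ‖a‖ ≤ ρ / 8) :
    c₀ * ‖a‖ ^ 2 * volume.real (Metric.ball p β) ≤
      2 * ρ * ∫ y in Metric.ball (0 : E) ρ, excessDiff φ a b η y := by
  have ha0 : 0 < ‖a‖ := norm_pos_iff.mpr ha
  -- `K` steps cover at least `ρ / 4`, far enough for the slope estimate, and at most `ρ / 4 + ρ /
  -- 8`, so with `‖y‖ ≤ ρ / 2` the segment stays inside `B_ρ(0)`.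
  set K : ℕ := ⌈ρ / 4 / ‖a‖⌉₊
  have hK1 : ρ / 4 ≤ K * ‖a‖ := by
    rw [← div_le_iff₀ ha0]
    exact Nat.le_ceil _
  have hK2 : K * ‖a‖ ≤ ρ / 4 + ‖a‖ := by
    have := mul_le_mul_of_nonneg_right
      (Nat.ceil_lt_add_one (show 0 ≤ ρ / 4 / ‖a‖ by positivity)).le ha0.le
    rwa [add_mul, div_mul_cancel₀ _ ha0.ne', one_mul] at this
  have key := mul_volume_ball_le (Finset.range (2 * K + 1)) (fun j => ((j : ℝ) - K) • a)
    (continuous_excessDiff (h.continuous hC0 hC) a b η)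
    (h.excessDiff_nonneg a b η) (p := p) (β := β) (ρ := ρ) (σ := c₀ * ‖a‖) (by
      intro j hj y hy
      rw [Finset.mem_range] at hj
      have hj' : (j : ℝ) ≤ 2 * K := by exact_mod_cast Nat.lt_succ_iff.mp hj
      have habs : |(j : ℝ) - K| ≤ K := by
        rw [abs_le]; constructor <;> linarith [(Nat.cast_nonneg j : (0 : ℝ) ≤ j)]
      have hn : ‖((j : ℝ) - K) • a‖ ≤ K * ‖a‖ := by
        rw [norm_smul, Real.norm_eq_abs]
        exact mul_le_mul_of_nonneg_right habs ha0.le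
      rw [Metric.mem_ball, dist_zero_right]
      have h1 := norm_add_le y (((j : ℝ) - K) • a)
      have h2 := hball y hy
      linarith) (by
      intro y hy
      refine (h.mul_norm_le_sum hC hc₀ hφ (T := ρ / 4) (by positivity) hK1 ?_).trans
        (Finset.sum_le_sum fun j _ => le_excessDiff_of_le (hlevel y hy _) a b)
      have := mul_le_mul_of_nonneg_left (hball y hy) (by positivity : 0 ≤ c₀ + C)
      linarith)
  rw [Finset.card_range] at key
  push_cast at key
  set J := ∫ y in Metric.ball (0 : E) ρ, excessDiff φ a b η y
  have hJ : 0 ≤ J := integral_nonneg fun y => h.excessDiff_nonneg a b η y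
  have h5 : ‖a‖ * (2 * K + 1) ≤ 2 * ρ := by nlinarith
  nlinarith [mul_le_mul_of_nonneg_right h5 hJ, mul_le_mul_of_nonneg_left key ha0.le]

end SupportFunction

/-! ### The uniform local bound: level-set kink against kink at the origin -/

section LocalBound

variable {E : Type*} [NormedAddCommGroup E] [InnerProductSpace ℝ E] [FiniteDimensional ℝ E]

lemma exists_norm_eq_one_inner_eq_zero (hE : 2 ≤ Module.finrank ℝ E) (a : E) :
    ∃ u : E, ‖u‖ = 1 ∧ inner ℝ u a = 0 := by
  have h1 := (Submodule.span ℝ {a}).finrank_add_finrank_orthogonal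
  have h2 : Module.finrank ℝ (Submodule.span ℝ {a}) ≤ 1 := by
    simpa using finrank_span_le_card (R := ℝ) ({a} : Set E)
  have : Nontrivial (Submodule.span ℝ {a})ᗮ :=
    Module.nontrivial_of_finrank_pos (R := ℝ) (by omega)
  obtain ⟨⟨v, hv⟩, hv0⟩ := exists_ne (0 : (Submodule.span ℝ {a})ᗮ)
  have hv0 : v ≠ 0 := fun h => hv0 (by simpa using h)
  refine ⟨(‖v‖)⁻¹ • v, norm_smul_inv_norm hv0, ?_⟩
  rw [real_inner_smul_left, Submodule.mem_orthogonal_singleton_iff_inner_left.mp hv, mul_zero]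

variable [MeasurableSpace E] [BorelSpace E] {φ : E → ℝ} {D : Set E} {C c₀ ρ η₀ : ℝ}

lemma volume_real_ball (p : E) {β : ℝ} (hβ : 0 < β) :
    volume.real (Metric.ball p β) =
      β ^ Module.finrank ℝ E * volume.real (Metric.ball (0 : E) 1) := by
  rw [Measure.real, Measure.addHaar_ball_of_pos volume p hβ, ENNReal.toReal_mul,
    ENNReal.toReal_ofReal (by positivity), Measure.real]

lemma volume_real_ball_pos (p : E) {β : ℝ} (hβ : 0 < β) : 0 < volume.real (Metric.ball p β) :=
  ENNReal.toReal_pos (Metric.measure_ball_pos volume p hβ).ne' measure_ball_lt_top.ne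

/-- By homogeneity, scaling by `τ = η / η₀` carries the ball at level `η₀` to one at level `η`,
still in the cone and in `B_ρ(0)`. One factor `τ β` of its volume cancels against the number of
translates; the remaining power `(τ β) ^ N` is bounded below if `η ≥ ε`, and equals `1` in dimension
one. Thus `c` does not depend on `η`, while `R` may. -/
lemma IsMaxOf.exists_sq_le_integral_of_cell (h : IsMaxOf φ D) (hφc : Continuous φ)
    (hE : 0 < Module.finrank ℝ E) (hη₀ : 0 < η₀) {d : E} (hd : d ∈ D) {p : E} {β : ℝ}
    (hβ : 0 < β) (hp : inner ℝ d p = η₀)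
    (hsub : Metric.ball p (3 * β) ⊆ Metric.ball 0 ρ ∩ {z | inner ℝ d z = φ z})
    {ε : ℝ} (hε : 0 < ε) :
    ∃ c : ℝ, 0 < c ∧ ∀ η, 0 < η → η ≤ η₀ → (ε ≤ η ∨ Module.finrank ℝ E = 1) →
      ∃ R : ℝ, 0 < R ∧ ∀ (a : E) (b : ℝ), 0 < |inner ℝ d a - b| → |inner ℝ d a - b| ≤ R →
        c * (inner ℝ d a - b) ^ 2 ≤ ∫ y in Metric.ball (0 : E) ρ, excessDiff φ a b η y := by
  have hd0 : 0 < ‖d‖ := by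
    refine norm_pos_iff.mpr ?_
    rintro rfl
    rw [inner_zero_left] at hp
    exact hη₀.ne hp
  set ω := volume.real (Metric.ball (0 : E) 1)
  have hω : 0 < ω := volume_real_ball_pos 0 one_pos
  obtain ⟨N, hN⟩ : ∃ N, Module.finrank ℝ E = N + 1 := ⟨_, (Nat.succ_pred_eq_of_pos hE).symm⟩
  refine ⟨(ε / η₀ * β) ^ N * ω / (10 * ‖d‖), by positivity, fun η hη hηη₀ hcase => ?_⟩
  set τ := η / η₀
  have hτ : 0 < τ := by positivity
  have hτ1 : τ ≤ 1 := (div_le_one hη₀).mpr hηη₀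
  refine ⟨τ * β * ‖d‖ / 2, by positivity, fun a b hα hαR => ?_⟩
  have key := h.mul_volume_le_of_ball_subset hφc hd (p := τ • p) (β := τ * β) (ρ := ρ) (η := η)
    (by rw [real_inner_smul_right, hp]; exact div_mul_cancel₀ _ hη₀.ne') (by
      intro y hy
      have hy' : τ⁻¹ • y ∈ Metric.ball p (3 * β) := by
        rw [Metric.mem_ball, dist_eq_norm] at hy ⊢
        rw [show τ⁻¹ • y - p = τ⁻¹ • (y - τ • p) by rw [smul_sub, inv_smul_smul₀ hτ.ne'],
          norm_smul, norm_inv, Real.norm_eq_abs, abs_of_pos hτ, inv_mul_lt_iff₀ hτ]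
        linarith
      obtain ⟨h1, h2⟩ := hsub hy'
      have hyτ : y = τ • (τ⁻¹ • y) := (smul_inv_smul₀ hτ.ne' y).symm
      constructor
      · rw [mem_ball_zero_iff] at h1 ⊢
        rw [hyτ, norm_smul, Real.norm_eq_abs, abs_of_pos hτ]
        nlinarith [norm_nonneg (τ⁻¹ • y)]
      · change inner ℝ d y = φ y
        rw [hyτ, real_inner_smul_right, h.smul hτ.le, h2]) hα hαR
  have hpow : (ε / η₀ * β) ^ N ≤ (τ * β) ^ N := by
    rcases hcase with hc | hc
    · have : ε / η₀ ≤ τ := div_le_div_of_nonneg_right hc hη₀.le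
      gcongr
    · obtain rfl : N = 0 := by omega
      simp
  rw [volume_real_ball _ (by positivity), hN] at key
  set J := ∫ y in Metric.ball (0 : E) ρ, excessDiff φ a b η y
  have key' : (inner ℝ d a - b) ^ 2 * ((τ * β) ^ N * ω) ≤ 10 * ‖d‖ * J := by
    refine le_of_mul_le_mul_right ?_ (show 0 < τ * β by positivity)
    calc (inner ℝ d a - b) ^ 2 * ((τ * β) ^ N * ω) * (τ * β)
        = (inner ℝ d a - b) ^ 2 * ((τ * β) ^ (N + 1) * ω) := by ring
      _ ≤ 10 * ‖d‖ * (τ * β) * J := key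
      _ = 10 * ‖d‖ * J * (τ * β) := by ring
  rw [div_mul_eq_mul_div, div_le_iff₀ (by positivity)]
  have := mul_le_mul_of_nonneg_left hpow (show 0 ≤ (inner ℝ d a - b) ^ 2 * ω by positivity)
  linarith

lemma IsMaxOf.exists_sq_le_integral (h : IsMaxOf φ D) (hφc : Continuous φ)
    (hE : 0 < Module.finrank ℝ E) (hη₀ : 0 < η₀) (hD : D.Finite)
    (hcell : ∀ d ∈ D, ∃ (p : E) (β : ℝ), 0 < β ∧ inner ℝ d p = η₀ ∧
      Metric.ball p (3 * β) ⊆ Metric.ball 0 ρ ∩ {z | inner ℝ d z = φ z})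
    {ε : ℝ} (hε : 0 < ε) :
    ∃ c : ℝ, 0 < c ∧ ∀ d ∈ D, ∀ η, 0 < η → η ≤ η₀ → (ε ≤ η ∨ Module.finrank ℝ E = 1) →
      ∃ R : ℝ, 0 < R ∧ ∀ (a : E) (b : ℝ), 0 < |inner ℝ d a - b| → |inner ℝ d a - b| ≤ R →
        c * (inner ℝ d a - b) ^ 2 ≤ ∫ y in Metric.ball (0 : E) ρ, excessDiff φ a b η y := by
  have hev : ∀ᶠ c : ℝ in nhdsWithin 0 (Set.Ioi 0), ∀ d ∈ D, ∀ η, 0 < η → η ≤ η₀ →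
      (ε ≤ η ∨ Module.finrank ℝ E = 1) → ∃ R : ℝ, 0 < R ∧ ∀ (a : E) (b : ℝ),
      0 < |inner ℝ d a - b| → |inner ℝ d a - b| ≤ R →
        c * (inner ℝ d a - b) ^ 2 ≤ ∫ y in Metric.ball (0 : E) ρ, excessDiff φ a b η y := by
    refine (Filter.eventually_all_finite hD).mpr fun d hd => ?_
    obtain ⟨p, β, hβ, hp, hsub⟩ := hcell d hd
    obtain ⟨c, hc, H⟩ := h.exists_sq_le_integral_of_cell hφc hE hη₀ hd hβ hp hsub hε
    filter_upwards [(gt_mem_nhds hc).filter_mono nhdsWithin_le_nhds] with c' hc' η h1 h2 h3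
    obtain ⟨R, hR, H⟩ := H η h1 h2 h3
    exact ⟨R, hR, fun a b h4 h5 =>
      (mul_le_mul_of_nonneg_right hc'.le (sq_nonneg _)).trans (H a b h4 h5)⟩
  obtain ⟨c, hc, hc0⟩ := (hev.and self_mem_nhdsWithin).exists
  exact ⟨c, hc0, hc⟩

/-- For `η ≤ 0` every line is above the level, as `φ ≥ 0`. For small `η > 0` the lines must miss the
origin: the ball is shifted by `r₁ / 2` along a unit vector orthogonal to `a`, whence the need for
dimension at least two. The lines then keep distance `r₁ / 4` from `0`, where `φ ≥ c₀ r₁ / 4`, the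
chosen `ε`. -/
lemma IsMaxOf.exists_norm_sq_le_integral (h : IsMaxOf φ D) (hC0 : 0 ≤ C)
    (hC : ∀ d ∈ D, ‖d‖ ≤ C) (hc₀ : 0 < c₀) (hφ : ∀ t, c₀ * ‖t‖ ≤ φ t) (hρ : 0 < ρ) :
    ∃ c ε : ℝ, 0 < c ∧ 0 < ε ∧ ∀ η, (η ≤ 0 ∨ 2 ≤ Module.finrank ℝ E ∧ η ≤ ε) →
      ∀ (a : E) (b : ℝ), a ≠ 0 → ‖a‖ ≤ ρ / 8 →
        c * ‖a‖ ^ 2 ≤ ∫ y in Metric.ball (0 : E) ρ, excessDiff φ a b η y := by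
  obtain ⟨r₁, hr₁, hr₁', hr₁ρ⟩ : ∃ r₁ : ℝ, 0 < r₁ ∧ (c₀ + C) * r₁ ≤ c₀ * ρ / 8 ∧ r₁ ≤ ρ / 2 := by
    refine ⟨min (c₀ * ρ / 8 / (c₀ + C)) (ρ / 2), by positivity, ?_, min_le_right _ _⟩
    rw [← le_div_iff₀' (by positivity)]
    exact min_le_left _ _
  set ω := volume.real (Metric.ball (0 : E) (r₁ / 4))
  have hω : 0 < ω := volume_real_ball_pos 0 (by positivity)
  refine ⟨c₀ * ω / (2 * ρ), c₀ * (r₁ / 4), by positivity, by positivity,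
    fun η hη a b ha haρ => ?_⟩
  obtain ⟨p, hp, hlevel⟩ : ∃ p : E, ‖p‖ ≤ r₁ / 2 ∧
      ∀ y ∈ Metric.ball p (r₁ / 4), ∀ t : ℝ, η ≤ φ (y + t • a) := by
    rcases hη with hη | ⟨hE, hη⟩
    · refine ⟨0, by simpa using by positivity, fun y _ t => hη.trans ?_⟩
      exact le_trans (by positivity) (hφ _)
    · obtain ⟨u, hu, hua⟩ := exists_norm_eq_one_inner_eq_zero hE a
      refine ⟨(r₁ / 2) • u, ?_, fun y hy t => hη.trans (le_trans ?_ (hφ _))⟩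
      · rw [norm_smul, hu, mul_one, Real.norm_eq_abs, abs_of_pos (by positivity)]
      · refine mul_le_mul_of_nonneg_left ?_ hc₀.le
        have h1 : inner ℝ u (y + t • a) = r₁ / 2 + inner ℝ u (y - (r₁ / 2) • u) := by
          rw [inner_add_right, inner_sub_right, real_inner_smul_right, real_inner_smul_right,
            hua, real_inner_self_eq_norm_sq, hu]
          ring
        have h2 := real_inner_le_norm u (y + t • a)
        have h3 := (abs_le.mp (abs_real_inner_le_norm u (y - (r₁ / 2) • u))).1
        rw [Metric.mem_ball, dist_eq_norm] at hy
        rw [hu, one_mul] at h2 h3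
        linarith
  have key := h.norm_sq_mul_volume_le hC0 hC hc₀ hφ (p := p) (a := a) (b := b) (β := r₁ / 4)
    hρ hr₁' hr₁ρ (fun y hy => by
      rw [Metric.mem_ball, dist_eq_norm] at hy
      have := norm_sub_norm_le y p
      linarith) hlevel ha haρ
  rw [volume_real_ball p (by positivity), ← volume_real_ball 0 (by positivity)] at key
  rw [div_mul_eq_mul_div, div_le_iff₀ (by positivity)]
  linarith

/-- Uniform lower bound for the second differences of the excess integrated over `B_ρ(0)`. -/
theorem IsMaxOf.exists_le_integral_excessDiff (h : IsMaxOf φ D) (hD : D.Finite) (hC0 : 0 ≤ C)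
    (hC : ∀ d ∈ D, ‖d‖ ≤ C) (hc₀ : 0 < c₀) (hφ : ∀ t, c₀ * ‖t‖ ≤ φ t) (hρ : 0 < ρ)
    (hη₀ : 0 < η₀)
    (hcell : ∀ d ∈ D, ∃ (p : E) (β : ℝ), 0 < β ∧ inner ℝ d p = η₀ ∧
      Metric.ball p (3 * β) ⊆ Metric.ball 0 ρ ∩ {z | inner ℝ d z = φ z}) :
    ∃ c : ℝ, 0 < c ∧ ∀ η ≤ η₀, ∀ (v : E) (k : ℝ), ∃ δ₀ : ℝ, 0 < δ₀ ∧ ∀ δ, 0 < δ → δ < δ₀ →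
      c * ‖v‖ ^ 2 * δ ^ 2 ≤
        ∫ y in Metric.ball (0 : E) ρ, excessDiff φ (δ • v) (δ * k) η y := by
  obtain ⟨c₁, ε, hc₁, hε, H₁⟩ := h.exists_norm_sq_le_integral hC0 hC hc₀ hφ hρ
  obtain ⟨c₂, hc₂, H₂⟩ : ∃ c : ℝ, 0 < c ∧ (0 < Module.finrank ℝ E → ∀ d ∈ D, ∀ η, 0 < η →
      η ≤ η₀ → (ε ≤ η ∨ Module.finrank ℝ E = 1) →
      ∃ R : ℝ, 0 < R ∧ ∀ (a : E) (b : ℝ), 0 < |inner ℝ d a - b| → |inner ℝ d a - b| ≤ R →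
        c * (inner ℝ d a - b) ^ 2 ≤ ∫ y in Metric.ball (0 : E) ρ, excessDiff φ a b η y) := by
    rcases Nat.eq_zero_or_pos (Module.finrank ℝ E) with hE | hE
    · exact ⟨1, one_pos, fun h => absurd h (by omega)⟩
    · obtain ⟨c, hc, H⟩ := h.exists_sq_le_integral (h.continuous hC0 hC) hE hη₀ hD hcell hε
      exact ⟨c, hc, fun _ => H⟩
  refine ⟨min c₁ (c₂ * c₀ ^ 2), by positivity, fun η hη v k => ?_⟩
  rcases eq_or_ne v 0 with rfl | hv
  · refine ⟨1, one_pos, fun δ _ _ => ?_⟩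
    rw [norm_zero, zero_pow two_ne_zero, mul_zero, zero_mul]
    exact integral_nonneg fun y => h.excessDiff_nonneg _ _ _ _
  have hv' : 0 < ‖v‖ := norm_pos_iff.mpr hv
  have hE : 0 < Module.finrank ℝ E :=
    Module.finrank_pos_iff_exists_ne_zero.mpr ⟨v, hv⟩
  by_cases hcase : η ≤ 0 ∨ 2 ≤ Module.finrank ℝ E ∧ η ≤ ε
  · refine ⟨ρ / 8 / ‖v‖, by positivity, fun δ hδ hδ₀ => ?_⟩
    have hn : ‖δ • v‖ = δ * ‖v‖ := by rw [norm_smul, Real.norm_eq_abs, abs_of_pos hδ]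
    refine le_trans ?_ (H₁ η hcase (δ • v) (δ * k) (smul_ne_zero hδ.ne' hv) ?_)
    · rw [hn, mul_pow, mul_assoc, mul_comm (δ ^ 2)]
      exact mul_le_mul_of_nonneg_right (min_le_left _ _) (by positivity)
    · rw [hn]
      exact ((lt_div_iff₀ hv').mp hδ₀).le
  · push Not at hcase
    obtain ⟨hη0, hcase⟩ := hcase
    -- A vertex active at `-v` or at `v`, according to the sign of `k`, makes `⟪d, v⟫` and `-k`
    -- reinforce each other; this is why the bound does not depend on `k`.
    obtain ⟨d, hd, hdv⟩ : ∃ d ∈ D, c₀ * ‖v‖ ≤ |inner ℝ d v - k| := by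
      rcases le_total 0 k with hk | hk
      · obtain ⟨d, hd, hdv⟩ := h.exists_eq (-v)
        have := hφ (-v)
        rw [← hdv, inner_neg_right, norm_neg] at this
        exact ⟨d, hd, le_trans (by linarith) (neg_le_abs _)⟩
      · obtain ⟨d, hd, hdv⟩ := h.exists_eq v
        have := hφ v
        exact ⟨d, hd, le_trans (by linarith) (le_abs_self _)⟩
    have hpos : 0 < |inner ℝ d v - k| := lt_of_lt_of_le (by positivity) hdv
    obtain ⟨R, hR, H⟩ := H₂ hE d hd η hη0 hη (by
      by_cases h1 : Module.finrank ℝ E = 1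
      · exact Or.inr h1
      · exact Or.inl (hcase (by omega)).le)
    refine ⟨R / |inner ℝ d v - k|, by positivity, fun δ hδ hδ₀ => ?_⟩
    have e : inner ℝ d (δ • v) - δ * k = δ * (inner ℝ d v - k) := by
      rw [real_inner_smul_right]; ring
    refine le_trans ?_ (H (δ • v) (δ * k) ?_ ?_)
    · rw [e, mul_pow, ← sq_abs (inner ℝ d v - k)]
      have h1 : (c₀ * ‖v‖) ^ 2 ≤ |inner ℝ d v - k| ^ 2 := by gcongr
      have h2 := min_le_right c₁ (c₂ * c₀ ^ 2)
      calc min c₁ (c₂ * c₀ ^ 2) * ‖v‖ ^ 2 * δ ^ 2 ≤ (c₂ * c₀ ^ 2) * ‖v‖ ^ 2 * δ ^ 2 := by gcongr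
        _ = c₂ * (δ ^ 2 * (c₀ * ‖v‖) ^ 2) := by ring
        _ ≤ _ := by gcongr
    · rw [e, abs_mul, abs_of_pos hδ]
      positivity
    · rw [e, abs_mul, abs_of_pos hδ]
      exact ((lt_div_iff₀ hpos).mp hδ₀).le

end LocalBound

/-! ### From local second differences to strong convexity of the expectation -/

/-- A continuous function whose symmetric second differences with small step `δ` are at least
`c δ²` satisfies the strong convexity inequality. -/
lemma le_of_secondDiff_ge {u : ℝ → ℝ} {c : ℝ} (hu : ContinuousOn u (Set.Icc 0 1))
    (h : ∀ t, 0 < t → t < 1 → ∃ δ₀ : ℝ, 0 < δ₀ ∧ ∀ δ, 0 < δ → δ < δ₀ →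
      c * δ ^ 2 ≤ u (t + δ) + u (t - δ) - 2 * u t)
    {l : ℝ} (hl0 : 0 < l) (hl1 : l < 1) :
    u l ≤ l * u 1 + (1 - l) * u 0 - c / 2 * l * (1 - l) := by
  refine le_of_forall_pos_le_add fun ε hε => ?_
  -- Lowering `c` makes the second difference of `v` at least `ε δ² > 0`, which is impossible at an
  -- interior maximum. As `v` vanishes at both endpoints, `v ≤ 0`.
  set c' := c - ε
  let v : ℝ → ℝ := fun t => u t - (t * u 1 + (1 - t) * u 0 - c' / 2 * t * (1 - t))
  have hv : ContinuousOn v (Set.Icc 0 1) := hu.sub (by fun_prop)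
  obtain ⟨t, ht, hmax⟩ := isCompact_Icc.exists_isMaxOn (Set.nonempty_Icc.mpr zero_le_one) hv
  have hle : v t ≤ 0 := by
    by_contra! hpos
    have ht0 : 0 < t := by
      refine ht.1.lt_of_ne ?_
      rintro rfl
      simp [v] at hpos
    have ht1 : t < 1 := by
      refine ht.2.lt_of_ne ?_
      rintro rfl
      simp [v] at hpos
    obtain ⟨δ₀, hδ₀, H⟩ := h t ht0 ht1
    obtain ⟨δ, hδ, hδ'⟩ := exists_between (show 0 < min δ₀ (min t (1 - t)) from
      lt_min hδ₀ (lt_min ht0 (by linarith)))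
    rw [lt_min_iff, lt_min_iff] at hδ'
    have h1 := hmax (show t + δ ∈ Set.Icc (0 : ℝ) 1 from ⟨by linarith, by linarith⟩)
    have h2 := hmax (show t - δ ∈ Set.Icc (0 : ℝ) 1 from ⟨by linarith, by linarith⟩)
    have h3 := H δ hδ hδ'.1
    simp only [v, Set.mem_ofPred_eq] at h1 h2
    have h4 : 0 < ε * δ ^ 2 := by positivity
    simp only [c'] at h1 h2
    nlinarith
  have hl := (hmax (show l ∈ Set.Icc (0 : ℝ) 1 from ⟨hl0.le, hl1.le⟩)).trans hle
  simp only [v, c'] at hl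
  have : l * (1 - l) ≤ 1 := by nlinarith
  nlinarith [mul_nonneg hl0.le (sub_nonneg.mpr hl1.le)]

variable {s : ℕ}

lemma HasDensityAtLeast.smul_restrict_le {μ : Measure (Vec s)} {V : Set (Vec s)} {r ρ : ℝ}
    (h : HasDensityAtLeast μ V r ρ) {x : Vec s} (hx : x ∈ V) :
    ENNReal.ofReal r • volume.restrict (Metric.ball x ρ) ≤ μ := by
  obtain ⟨θ, -, rfl, hθ⟩ := h
  rw [← withDensity_const]
  refine le_trans (withDensity_mono ?_) ((restrict_withDensity measurableSet_ball θ).symm.le.trans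
    Measure.restrict_le_self)
  rw [Filter.EventuallyLE, ae_restrict_iff' measurableSet_ball]
  filter_upwards [hθ] with z hz hzx
  refine hz ⟨x, hx, z - x, ?_, add_sub_cancel x z⟩
  rwa [mem_ball_zero_iff, ← dist_eq_norm]

variable {φ : Vec s → ℝ} {D : Set (Vec s)} {C : ℝ} {μ : Measure (Vec s)} [IsFiniteMeasure μ]

lemma IsMaxOf.integrable_excessOver (h : IsMaxOf φ D) (hC0 : 0 ≤ C) (hC : ∀ d ∈ D, ‖d‖ ≤ C)
    (hμ : Integrable (fun z : Vec s => ‖z‖) μ) (x : Vec s) (η : ℝ) :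
    Integrable (fun z => excessOver φ η (z - x)) μ := by
  refine Integrable.mono' (g := fun z => C * ‖z‖ + (C * ‖x‖ + |excessOver φ η 0|))
    ((hμ.const_mul C).add (integrable_const _))
    ((continuous_excessOver (h.continuous hC0 hC) η).comp
      (by fun_prop : Continuous fun z => z - x)).aestronglyMeasurable
    (ae_of_all _ fun z => ?_)
  have h1 := h.abs_excessOver_sub_le hC (z - x) 0 η η
  rw [sub_self, abs_zero, sub_zero, add_zero] at h1
  have h2 := mul_le_mul_of_nonneg_left (norm_sub_le z x) hC0
  have h3 := abs_sub_abs_le_abs_sub (excessOver φ η (z - x)) (excessOver φ η 0)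
  rw [Real.norm_eq_abs]
  linarith

/-- The second difference of the expectation is the `μ`-integral of a nonnegative function, so it
only decreases when `μ` is replaced by `r` times Lebesgue measure on `B_ρ(x)`. The sign of `a` flips
because `x` enters through `z - x`. -/
lemma IsMaxOf.mul_integral_excessDiff_le (h : IsMaxOf φ D) (hC0 : 0 ≤ C)
    (hC : ∀ d ∈ D, ‖d‖ ≤ C) (hμ : Integrable (fun z : Vec s => ‖z‖) μ) {V : Set (Vec s)}
    {r ρ : ℝ} (hr : 0 ≤ r) (hdens : HasDensityAtLeast μ V r ρ) {x : Vec s} (hx : x ∈ V)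
    (a : Vec s) (b η : ℝ) :
    r * ∫ y in Metric.ball (0 : Vec s) ρ, excessDiff φ (-a) b η y ≤
      (∫ z, excessOver φ (η + b) (z - (x + a)) ∂μ) + (∫ z, excessOver φ (η - b) (z - (x - a)) ∂μ)
        - 2 * ∫ z, excessOver φ η (z - x) ∂μ := by
  have hi := fun x η => h.integrable_excessOver hC0 hC hμ x η
  have he : ∀ z, excessDiff φ (-a) b η (z - x) = excessOver φ (η + b) (z - (x + a)) +
      excessOver φ (η - b) (z - (x - a)) - 2 * excessOver φ η (z - x) := fun z => by
    rw [excessDiff, show z - x + -a = z - (x + a) by abel, show z - x - -a = z - (x - a) by abel]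
  have hR : ∫ z, excessDiff φ (-a) b η (z - x) ∂μ =
      (∫ z, excessOver φ (η + b) (z - (x + a)) ∂μ) + (∫ z, excessOver φ (η - b) (z - (x - a)) ∂μ)
        - 2 * ∫ z, excessOver φ η (z - x) ∂μ := by
    have hadd : Integrable (fun z => excessOver φ (η + b) (z - (x + a)) +
        excessOver φ (η - b) (z - (x - a))) μ := (hi _ _).add (hi _ _)
    simp only [he]
    rw [integral_sub hadd ((hi _ _).const_mul 2),
      integral_add (hi _ _) (hi _ _), integral_const_mul]
  rw [← hR]
  have hint : Integrable (fun z => excessDiff φ (-a) b η (z - x)) μ := by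
    simp only [he]
    exact ((hi _ _).add (hi _ _)).sub ((hi _ _).const_mul 2)
  have hmp := measurePreserving_sub_right (volume : Measure (Vec s)) x
  have hball : (fun z => z - x) ⁻¹' Metric.ball (0 : Vec s) ρ = Metric.ball x ρ := by
    ext z
    simp [dist_eq_norm]
  rw [← hmp.setIntegral_preimage_emb (measurableEmbedding_subRight x), hball]
  have := integral_mono_measure (hdens.smul_restrict_le hx)
    (ae_of_all _ fun z => h.excessDiff_nonneg (-a) b η (z - x)) hint
  rwa [integral_smul_measure, ENNReal.toReal_ofReal hr, smul_eq_mul] at this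

lemma IsMaxOf.abs_integral_excessOver_sub_le [IsProbabilityMeasure μ] (h : IsMaxOf φ D)
    (hC0 : 0 ≤ C) (hC : ∀ d ∈ D, ‖d‖ ≤ C) (hμ : Integrable (fun z : Vec s => ‖z‖) μ)
    (x x' : Vec s) (η η' : ℝ) :
    |(∫ z, excessOver φ η (z - x) ∂μ) - ∫ z, excessOver φ η' (z - x') ∂μ| ≤
      C * ‖x - x'‖ + |η - η'| := by
  rw [← integral_sub (h.integrable_excessOver hC0 hC hμ x η)
    (h.integrable_excessOver hC0 hC hμ x' η'), ← Real.norm_eq_abs]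
  refine (norm_integral_le_of_norm_le_const (C := C * ‖x - x'‖ + |η - η'|)
    (ae_of_all _ fun z => ?_)).trans (by simp)
  have := h.abs_excessOver_sub_le hC (z - x) (z - x') η η'
  rwa [sub_sub_sub_cancel_left, norm_sub_rev] at this

theorem IsMaxOf.partiallyStronglyConvexOn [IsProbabilityMeasure μ] (h : IsMaxOf φ D)
    (hC0 : 0 ≤ C) (hC : ∀ d ∈ D, ‖d‖ ≤ C) (hμ : Integrable (fun z : Vec s => ‖z‖) μ)
    {V : Set (Vec s)} (hV : Convex ℝ V) {r ρ η₀ c : ℝ} (hr : 0 ≤ r)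
    (hdens : HasDensityAtLeast μ V r ρ)
    (hlocal : ∀ η ≤ η₀, ∀ (v : Vec s) (k : ℝ), ∃ δ₀ : ℝ, 0 < δ₀ ∧ ∀ δ, 0 < δ → δ < δ₀ →
      c * ‖v‖ ^ 2 * δ ^ 2 ≤
        ∫ y in Metric.ball (0 : Vec s) ρ, excessDiff φ (δ • v) (δ * k) η y) :
    PartiallyStronglyConvexOn (r * c) V (Set.Iic η₀)
      (fun x η => ∫ z, excessOver φ η (z - x) ∂μ) := by
  intro x₁ hx₁ x₂ hx₂ η₁ hη₁ η₂ hη₂ l hl0 hl1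
  let X : ℝ → Vec s := fun t => t • x₁ + (1 - t) • x₂
  let Y : ℝ → ℝ := fun t => t • η₁ + (1 - t) • η₂
  let u : ℝ → ℝ := fun t => ∫ z, excessOver φ (Y t) (z - X t) ∂μ
  have hX : Continuous X := by fun_prop
  have hY : Continuous Y := by fun_prop
  have hu : Continuous u := by
    refine continuous_iff_continuousAt.mpr fun t => ?_
    rw [ContinuousAt, tendsto_iff_dist_tendsto_zero]
    refine squeeze_zero (fun _ => dist_nonneg) (fun t' => (Real.dist_eq _ _).trans_le
      (h.abs_integral_excessOver_sub_le hC0 hC hμ (X t') (X t) (Y t') (Y t))) ?_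
    have hcont : Continuous fun t' => C * ‖X t' - X t‖ + |Y t' - Y t| := by fun_prop
    simpa using hcont.tendsto t
  have key := le_of_secondDiff_ge (u := u) (c := r * c * ‖x₁ - x₂‖ ^ 2) hu.continuousOn
    (fun t ht0 ht1 => by
      have hXt : X t ∈ V := hV hx₁ hx₂ ht0.le (by linarith) (by ring)
      have hYt : Y t ≤ η₀ := (convex_Iic η₀) hη₁ hη₂ ht0.le (by linarith) (by ring)
      -- The minus sign matches the step `-a` in `mul_integral_excessDiff_le`.
      obtain ⟨δ₀, hδ₀, H⟩ := hlocal (Y t) hYt (-(x₁ - x₂)) (η₁ - η₂)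
      refine ⟨δ₀, hδ₀, fun δ hδ hδ' => ?_⟩
      have h1 := mul_le_mul_of_nonneg_left (H δ hδ hδ') hr
      rw [smul_neg, norm_neg] at h1
      have h2 := h.mul_integral_excessDiff_le hC0 hC hμ hr hdens hXt (δ • (x₁ - x₂))
        (δ * (η₁ - η₂)) (Y t)
      have e1 : X (t + δ) = X t + δ • (x₁ - x₂) := by simp only [X]; module
      have e2 : X (t - δ) = X t - δ • (x₁ - x₂) := by simp only [X]; module
      have e3 : Y (t + δ) = Y t + δ * (η₁ - η₂) := by simp only [Y, smul_eq_mul]; ring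
      have e4 : Y (t - δ) = Y t - δ * (η₁ - η₂) := by simp only [Y, smul_eq_mul]; ring
      simp only [u, e1, e2, e3, e4]
      linarith) hl0 hl1
  simp only [u, X, Y] at key
  simp only [one_smul, zero_smul, sub_self, add_zero, sub_zero, zero_add] at key
  linarith

end TwoStage

/-! ### Assembly -/

theorem mainTheorem1 {s n : ℕ}
    (W : Matrix (Fin s) (Fin n) ℝ) (q : Fin n → ℝ)
    (μ : MeasureTheory.Measure (TwoStage.Vec s)) [MeasureTheory.IsProbabilityMeasure μ]
    (V : Set (TwoStage.Vec s)) (r ρ η₀ : ℝ)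
    (hcomplete : TwoStage.CompleteRecourse W)
    (hexpensive : TwoStage.StrictlyExpensiveRecourse W q)
    (hmoment : MeasureTheory.Integrable (fun z : TwoStage.Vec s => ‖z‖) μ)
    (hVconv : Convex ℝ V) (hVopen : IsOpen V) (hr : 0 < r) (hρ : 0 < ρ)
    (hdensity : TwoStage.HasDensityAtLeast μ V r ρ)
    (hthreshold : TwoStage.AdmissibleThreshold W q ρ η₀)
    (hq : ∀ j, 0 < q j) :
    (∀ (x : TwoStage.Vec s) (η : ℝ),
      MeasureTheory.Integrable (TwoStage.excess W q x η) μ) ∧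
    ∃ κ : ℝ, 0 < κ ∧
      TwoStage.PartiallyStronglyConvexOn κ V (Set.Iic η₀) (TwoStage.expectedExcess W q μ) := by
  obtain ⟨C, hC0, hC⟩ := TwoStage.exists_norm_le_of_mem_dualPolyhedron (q := q) hcomplete
  have hmax : TwoStage.IsMaxOf (TwoStage.valueFun W q) (TwoStage.dualVertices W q) :=
    ⟨fun d hd => TwoStage.inner_le_valueFun hcomplete hd.1,
      TwoStage.exists_dualVertex_optimal hcomplete hq⟩
  have hC' : ∀ d ∈ TwoStage.dualVertices W q, ‖d‖ ≤ C := fun d hd => hC d hd.1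
  refine ⟨hmax.integrable_excessOver hC0.le hC' hmoment, ?_⟩
  obtain ⟨c, hc, hlocal⟩ : ∃ c : ℝ, 0 < c ∧ ∀ η ≤ η₀, ∀ (v : TwoStage.Vec s) (k : ℝ),
      ∃ δ₀ : ℝ, 0 < δ₀ ∧ ∀ δ, 0 < δ → δ < δ₀ → c * ‖v‖ ^ 2 * δ ^ 2 ≤
        ∫ y in Metric.ball (0 : TwoStage.Vec s) ρ,
          TwoStage.excessDiff (TwoStage.valueFun W q) (δ • v) (δ * k) η y := by
    -- For `s = 0` there are no nonzero vertices to represent `φ`, but the claimed lower bound is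
    -- `0`. Otherwise `φ` is a maximum over the positive vertices alone, the ones for which the
    -- threshold provides balls.
    rcases Nat.eq_zero_or_pos s with rfl | hs
    · refine ⟨1, one_pos, fun η _ v k => ⟨1, one_pos, fun δ _ _ => ?_⟩⟩
      rw [Subsingleton.elim v 0, norm_zero, zero_pow two_ne_zero, mul_zero, zero_mul]
      exact integral_nonneg fun y => hmax.excessDiff_nonneg _ _ _ _
    · obtain ⟨c₀, hc₀, hφ⟩ := TwoStage.exists_mul_norm_le_valueFun hcomplete hq
      have hmax' : TwoStage.IsMaxOf (TwoStage.valueFun W q) (TwoStage.positiveVertices W q) :=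
        ⟨fun d hd => TwoStage.inner_le_valueFun hcomplete hd.1.1,
          TwoStage.exists_positiveVertex_optimal hcomplete hq hs⟩
      exact hmax'.exists_le_integral_excessDiff
        (TwoStage.dualVertices_finite.subset fun d hd => hd.1) hC0.le (fun d hd => hC' d hd.1)
        hc₀ hφ hρ hthreshold.1
        fun d hd => hthreshold.exists_ball_subset hcomplete hq hd
  exact ⟨r * c, mul_pos hr hc, hmax.partiallyStronglyConvexOn hC0.le hC' hmoment hVconv hr.le
    hdensity hlocal⟩
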